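/- Let $p$ be a prime, let $m>1$ be an integer not divisible by $p$, and let $0<i<m$. For a rational number $k=a/b$ with $a,b\in\mathbb Z$ and $(b,m)=1$ let $[k]_m$ be the integer with $0\le [k]_m<m$ and $b\,[k]_m\equiv a \pmod m$. For $r\ge 0$ define the integer $k_r(i)$ by $p\,[ip^{-(r+1)}]_m=[ip^{-r}]_m+k_r(i)\,m$ (then $0\le k_r(i)\le p-1$). For $n\ge 0$ and $0\le a<p^n$ put $\delta_n(a)=-1$ if $a\ge 1+\sum_{\alpha=0}^{n-1}(p-1-k_\alpha(i))p^\alpha$, and $\delta_n(a)=0$ otherwise. Let $\mu(\frac im)$ be the $\mathbb Z_p$-valued measure on $\mathbb Z_p$ given by $$\mu\Big(\frac im\Big)(a+p^n\mathbb Z_p)=\frac{[ip^{-n}]_m}{m}+\delta_n(a)\qquad (n\ge 0,\ 0\le a<p^n),$$ and for $c\in\mathbb Z_p^\times$ with $c^{p-1}\ne 1$ let $\mu_c(\frac im)=\mu(\frac im)-c\,\mu(\frac im)\circ c^{-1}$, where $(\mu\circ c^{-1})(U)=\mu(c^{-1}U)$. Identify $\mathbb Z_p$-valued measures on $\mathbb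 Z_p$ with elements of the completed group ring $\mathbb Z_p[[\mathbb Z_p]]=\varprojlim_n \mathbb Z_p[\mathbb Z/p^n]$, a measure $\mu$ corresponding to the family $\big(\sum_{a}\mu(a+p^n\mathbb Z_p)\,(a)\big)_n$, and write $(x)\in\mathbb Z_p[[\mathbb Z_p]]$ for the group element of $x\in\mathbb Z_p$. There is exactly one isomorphism of $\mathbb Z_p$-algebras $P:\mathbb Z_p[[\mathbb Z_p]]\to\mathbb Z_p[[T]]$ with $P((1))=1+T$ (the Iwasawa isomorphism), and it satisfies $$P\Big(\mu\Big(\frac im\Big)\Big)=\frac{(1+T)^{i/m}-1}{T}$$ and, for every $c\in\mathbb Z_p^\times$ with $c^{p-1}\neq 1$, $$P\Big(\mu_c\Big(\frac im\Big)\Big)=\frac{(1+T)^{i/m}-1}{T}-\frac{c\,\big((1+T)^{ci/m}-1\big)}{(1+T)^c-1},$$ where $(1+T)^x=\sum_{n\ge 0}\binom xn T^n$ for $x\in\mathbb Z_p$ and the quotients are taken in the field of fractions of $\mathbb Z_p[[T]]$. -/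

import Mathlib

noncomputable section

/-- The transition map `ℤ_p[ℤ/p^(n+1)] → ℤ_p[ℤ/p^n]` of group rings induced by reduction. -/
def groupRingReduction (p : ℕ) [Fact p.Prime] (n : ℕ) :
    AddMonoidAlgebra ℤ_[p] (ZMod (p ^ (n + 1))) →ₐ[ℤ_[p]] AddMonoidAlgebra ℤ_[p] (ZMod (p ^ n)) :=
  AddMonoidAlgebra.mapDomainAlgHom ℤ_[p] ℤ_[p]
    (ZMod.castHom (pow_dvd_pow p n.le_succ) (ZMod (p ^ n))).toAddMonoidHom

/-- The compatible families in the product of the group rings `ℤ_p[ℤ/p^n]`, as a subalgebra. -/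
def compatibleFamilies (p : ℕ) [Fact p.Prime] :
    Subalgebra ℤ_[p] (∀ n : ℕ, AddMonoidAlgebra ℤ_[p] (ZMod (p ^ n))) where
  carrier := {f | ∀ n, groupRingReduction p n (f (n + 1)) = f n}
  mul_mem' hf hg n := by simp [hf n, hg n]
  add_mem' hf hg n := by simp [hf n, hg n]
  algebraMap_mem' r n := by
    simp only [Pi.algebraMap_apply]
    exact (groupRingReduction p n).commutes r

/-- The completed group ring `ℤ_p[[ℤ_p]]`, the inverse limit of the group rings `ℤ_p[ℤ/p^n]`.

Its elements are the `ℤ_p`-valued measures on `ℤ_p`: the coefficient at `a` of the `n`-th component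
of `μ` is the value `μ(a + p^n ℤ_p)`, and compatibility of the components says
`μ(a + p^n ℤ_p) = ∑_{b ≡ a mod p^n} μ(b + p^(n+1) ℤ_p)`. -/
abbrev IwasawaAlgebra (p : ℕ) [Fact p.Prime] : Type :=
  compatibleFamilies p

namespace IwasawaAlgebra

variable {p : ℕ} [Fact p.Prime]

/-- The value `μ(a + p^n ℤ_p)` of a measure on a coset of `p^n ℤ_p`. -/
def value (μ : IwasawaAlgebra p) (n : ℕ) (a : ZMod (p ^ n)) : ℤ_[p] :=
  ((μ : ∀ n : ℕ, AddMonoidAlgebra ℤ_[p] (ZMod (p ^ n))) n).coeff a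

/-- The group-like element `(x)` of `ℤ_p[[ℤ_p]]` (the Dirac measure) attached to `x ∈ ℤ_p`. -/
def single (x : ℤ_[p]) : IwasawaAlgebra p :=
  ⟨fun n => AddMonoidAlgebra.single (PadicInt.toZModPow n x) 1, fun n => by
    have h := congrArg (fun f => f x) (PadicInt.zmod_cast_comp_toZModPow (p := p) n (n + 1) n.le_succ)
    simp only [RingHom.comp_apply] at h
    simp [groupRingReduction, h]⟩

/-- The measure with prescribed values `v n a` on the cosets `a + p^n ℤ_p`, given additivity. -/
def ofValues (v : ∀ n : ℕ, ZMod (p ^ n) → ℤ_[p])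
    (hv : ∀ (n : ℕ) (a : ZMod (p ^ n)),
      ∑ b : ZMod (p ^ (n + 1)) with
        ZMod.castHom (pow_dvd_pow p n.le_succ) (ZMod (p ^ n)) b = a, v (n + 1) b = v n a) :
    IwasawaAlgebra p :=
  ⟨fun n => AddMonoidAlgebra.ofCoeff (Finsupp.equivFunOnFinite.symm (v n)), fun n => by
    ext a
    refine Eq.trans ?_ (hv n a)
    rw [Finset.sum_filter]
    simp [groupRingReduction, Finsupp.mapDomain, Finsupp.sum_fintype, Finsupp.finsetSum_apply,
      Finsupp.single_apply]
    refine Finset.sum_congr rfl fun x _ => ?_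
    congr⟩

theorem value_ofValues (v : ∀ n : ℕ, ZMod (p ^ n) → ℤ_[p]) (hv) (n : ℕ) (a : ZMod (p ^ n)) :
    (ofValues v hv).value n a = v n a := by
  simp [ofValues, value]

theorem sum_value (μ : IwasawaAlgebra p) (n : ℕ) (a : ZMod (p ^ n)) :
    ∑ b : ZMod (p ^ (n + 1)) with
      ZMod.castHom (pow_dvd_pow p n.le_succ) (ZMod (p ^ n)) b = a, μ.value (n + 1) b
        = μ.value n a := by
  have h := congrArg (fun f => f.coeff a) (μ.2 n)
  unfold value
  rw [← h, Finset.sum_filter]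
  simp [groupRingReduction, Finsupp.mapDomain, Finsupp.sum_fintype, Finsupp.finsetSum_apply,
      Finsupp.single_apply]
  refine Finset.sum_congr rfl fun x _ => ?_
  congr

/-- The measure `μ ∘ c⁻¹` for a unit `c` of `ℤ_p`: its value on `a + p^n ℤ_p` is
`μ(c⁻¹ (a + p^n ℤ_p)) = μ(c⁻¹ a + p^n ℤ_p)`. -/
def compInv (c : ℤ_[p]ˣ) (μ : IwasawaAlgebra p) : IwasawaAlgebra p :=
  ofValues (fun n a => μ.value n (PadicInt.toZModPow n (↑c⁻¹ : ℤ_[p]) * a)) fun n a => by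
    have hc : ∀ (k : ℕ), PadicInt.toZModPow k (c : ℤ_[p]) *
        PadicInt.toZModPow k (↑c⁻¹ : ℤ_[p]) = 1 := fun k => by
      rw [← map_mul]; simp
    have hcast : ∀ x : ℤ_[p], ZMod.castHom (pow_dvd_pow p n.le_succ) (ZMod (p ^ n))
        (PadicInt.toZModPow (n + 1) x) = PadicInt.toZModPow n x := fun x =>
      congrArg (fun f => f x) (PadicInt.zmod_cast_comp_toZModPow (p := p) n (n + 1) n.le_succ)
    rw [← sum_value μ n]
    refine Finset.sum_bij' (fun b _ => PadicInt.toZModPow (n + 1) (↑c⁻¹ : ℤ_[p]) * b)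
      (fun b _ => PadicInt.toZModPow (n + 1) (c : ℤ_[p]) * b) ?_ ?_ ?_ ?_ ?_
    · intro b hb
      simp only [Finset.mem_filter, Finset.mem_univ, true_and] at hb ⊢
      rw [map_mul, hcast, hb]
    · intro b hb
      simp only [Finset.mem_filter, Finset.mem_univ, true_and] at hb ⊢
      rw [map_mul, hcast, hb, ← mul_assoc, hc, one_mul]
    · intro b _
      rw [← mul_assoc, hc, one_mul]
    · intro b _
      rw [← mul_assoc, mul_comm (PadicInt.toZModPow (n + 1) (↑c⁻¹ : ℤ_[p])), hc, one_mul]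
    · intro b _
      rfl

end IwasawaAlgebra

/-- The residue `[k]_m` of a rational number `k`: for `k = a / b` with `b` prime to `m`, it is the
integer `0 ≤ [k]_m < m` with `b [k]_m ≡ a mod m`. -/
def ratResidue (m : ℕ) (k : ℚ) : ℕ :=
  ((k.num : ZMod m) * (k.den : ZMod m)⁻¹).val

theorem ratResidue_lt (m : ℕ) (hm : 0 < m) (k : ℚ) : ratResidue m k < m :=
  have : NeZero m := ⟨hm.ne'⟩
  ZMod.val_lt _

theorem ratResidue_spec (m : ℕ) (hm : 0 < m) (a b : ℤ) (hb : b ≠ 0) (hbm : IsCoprime b m) :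
    b * ratResidue m (a / b : ℚ) ≡ a [ZMOD m] := by
  have : NeZero m := ⟨hm.ne'⟩
  set k : ℚ := a / b with hk
  have hden : (k.den : ℤ) ∣ b := by
    rw [hk, Rat.intCast_div_eq_divInt]; exact Rat.den_dvd a b
  have hcop : Nat.Coprime k.den m := by
    rw [← Nat.isCoprime_iff_coprime]
    exact hbm.of_isCoprime_of_dvd_left hden
  have hab : k.num * b = a * k.den := by
    have h1 : k * b = a := by rw [hk]; field_simp
    have h2 : k * k.den = k.num := Rat.mul_den_eq_num k
    have : (k.num : ℚ) * b = a * k.den := by rw [← h1, ← h2]; ring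
    exact_mod_cast this
  rw [← ZMod.intCast_eq_intCast_iff]
  push_cast
  rw [ratResidue, ZMod.natCast_zmod_val]
  have hu := ZMod.coe_mul_inv_eq_one k.den hcop
  have hab' : (k.num : ZMod m) * b = a * k.den := by exact_mod_cast congrArg (Int.cast : ℤ → ZMod m) hab
  calc (b : ZMod m) * (k.num * (k.den : ZMod m)⁻¹) = (k.num * b) * (k.den : ZMod m)⁻¹ := by ring
    _ = a * (k.den * (k.den : ZMod m)⁻¹) := by rw [hab']; ring
    _ = a := by rw [hu, mul_one]

/-- The fraction `a / m` as a `p`-adic integer, for `m` prime to `p`. -/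
def padicFrac (p : ℕ) [Fact p.Prime] (m : ℕ) (hm : ¬ p ∣ m) (a : ℕ) : ℤ_[p] :=
  ⟨(a : ℚ_[p]) / (m : ℚ_[p]), by
    have h : ‖(m : ℚ_[p])‖ = 1 := by
      rw [← PadicInt.coe_natCast, ← PadicInt.norm_def]
      exact (PadicInt.norm_natCast_eq_one_iff).2
        (((Fact.out : p.Prime).coprime_iff_not_dvd).2 hm)
    have h2 : ‖(a : ℚ_[p])‖ ≤ 1 := by
      rw [← PadicInt.coe_natCast, ← PadicInt.norm_def]
      exact PadicInt.norm_le_one _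
    rw [norm_div, h, div_one]
    exact h2⟩

/-- The integers `[i p^(-r)]_m`. -/
def residueSeq (p m i r : ℕ) : ℕ := ratResidue m ((i : ℚ) / (p : ℚ) ^ r)

/-- The digits `k_r(i)`, determined by `p [i p^(-(r+1))]_m = [i p^(-r)]_m + k_r(i) m`. -/
def digit (p m i r : ℕ) : ℤ :=
  ((p : ℤ) * residueSeq p m i (r + 1) - residueSeq p m i r) / m

/-- The threshold `1 + ∑_{α < n} (p - 1 - k_α(i)) p^α`. -/
def threshold (p m i n : ℕ) : ℤ :=
  1 + ∑ α ∈ Finset.range n, ((p : ℤ) - 1 - digit p m i α) * (p : ℤ) ^ α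

/-- The step function `δ_n`. -/
def stepDelta (p m i n a : ℕ) : ℤ :=
  if threshold p m i n ≤ a then -1 else 0

theorem residueSeq_zero {p m i : ℕ} (hi : i < m) : residueSeq p m i 0 = i := by
  have : ((i : ℚ)).den = 1 := rfl
  simp [residueSeq, ratResidue, ZMod.val_natCast, Nat.mod_eq_of_lt hi]

theorem residueSeq_lt {p m i : ℕ} (hi : i < m) (r : ℕ) : residueSeq p m i r < m :=
  ratResidue_lt m (by omega) _

section Facts

variable {p m i : ℕ} [Fact p.Prime]

theorem digit_spec (hm : ¬ p ∣ m) (hm0 : 0 < m) (r : ℕ) :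
    (p : ℤ) * residueSeq p m i (r + 1) = residueSeq p m i r + digit p m i r * m := by
  have hp : p.Prime := Fact.out
  have hcop : ∀ k : ℕ, IsCoprime (((p ^ k : ℕ) : ℤ)) (m : ℤ) := fun k =>
    Nat.isCoprime_iff_coprime.2 (((hp.coprime_iff_not_dvd).2 hm).pow_left k)
  have hs : ∀ k : ℕ, ((p ^ k : ℕ) : ℤ) * residueSeq p m i k ≡ i [ZMOD m] := fun k => by
    have h := ratResidue_spec m hm0 (i : ℤ) ((p ^ k : ℕ) : ℤ)
      (by exact_mod_cast (pow_pos hp.pos k).ne') (hcop k)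
    simpa [residueSeq] using h
  have hd : (m : ℤ) ∣ (p : ℤ) * residueSeq p m i (r + 1) - residueSeq p m i r := by
    refine (hcop r).symm.dvd_of_dvd_mul_left ?_
    have h := ((hs (r + 1)).trans (hs r).symm).symm.dvd
    have e : ((p ^ r : ℕ) : ℤ) * ((p : ℤ) * residueSeq p m i (r + 1) - residueSeq p m i r)
        = ((p ^ (r + 1) : ℕ) : ℤ) * residueSeq p m i (r + 1)
          - ((p ^ r : ℕ) : ℤ) * residueSeq p m i r := by
      push_cast
      ring
    rw [e]
    exact h
  rw [digit, Int.ediv_mul_cancel hd]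
  ring

theorem residueSeq_pos (hm : ¬ p ∣ m) (hi0 : 0 < i) (hi : i < m) (r : ℕ) :
    0 < residueSeq p m i r := by
  induction r with
  | zero => rw [residueSeq_zero hi]; exact hi0
  | succ r ih =>
    rcases Nat.eq_zero_or_pos (residueSeq p m i (r + 1)) with h | h
    · exfalso
      have hs := digit_spec (i := i) hm (by omega) r
      rw [h] at hs
      have hlt := residueSeq_lt (p := p) hi r
      have hdvd : (m : ℤ) ∣ residueSeq p m i r := ⟨-digit p m i r, by push_cast at hs; linarith⟩
      exact absurd (Nat.le_of_dvd ih (by exact_mod_cast hdvd)) (by omega)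
    · exact h

theorem digit_nonneg (hm : ¬ p ∣ m) (hi0 : 0 < i) (hi : i < m) (r : ℕ) : 0 ≤ digit p m i r := by
  have hs := digit_spec (i := i) hm (by omega) r
  have h1 := residueSeq_lt (p := p) hi r
  have h2 := residueSeq_pos hm hi0 hi (r + 1)
  have hp : 0 < p := (Fact.out : p.Prime).pos
  by_contra hneg
  push Not at hneg
  have : digit p m i r * m ≤ -1 * m := by
    apply mul_le_mul_of_nonneg_right (by omega) (by positivity)
  have h3 : (0 : ℤ) < (p : ℤ) * residueSeq p m i (r + 1) := by positivity
  omega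

theorem digit_lt (hm : ¬ p ∣ m) (hi0 : 0 < i) (hi : i < m) (r : ℕ) : digit p m i r < p := by
  have hs := digit_spec (i := i) hm (by omega) r
  have h1 := residueSeq_lt (p := p) hi (r + 1)
  have h2 := residueSeq_pos hm hi0 hi r
  have hp : 0 < p := (Fact.out : p.Prime).pos
  have h3 : (p : ℤ) * residueSeq p m i (r + 1) < p * m := by
    apply mul_lt_mul_of_pos_left <;> exact_mod_cast (by assumption)
  have h4 : digit p m i r * m < p * m := by omega
  exact lt_of_mul_lt_mul_right h4 (by positivity)

theorem threshold_bounds (hm : ¬ p ∣ m) (hi0 : 0 < i) (hi : i < m) (n : ℕ) :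
    1 ≤ threshold p m i n ∧ threshold p m i n ≤ (p : ℤ) ^ n := by
  induction n with
  | zero => simp [threshold]
  | succ n ih =>
    have hs : threshold p m i (n + 1)
        = threshold p m i n + ((p : ℤ) - 1 - digit p m i n) * (p : ℤ) ^ n := by
      simp only [threshold, Finset.sum_range_succ]; ring
    have h0 := digit_nonneg hm hi0 hi n
    have h1 := digit_lt hm hi0 hi n
    have hpn : (0 : ℤ) ≤ (p : ℤ) ^ n := by positivity
    have ha : 0 ≤ ((p : ℤ) - 1 - digit p m i n) * (p : ℤ) ^ n :=
      mul_nonneg (by omega) hpn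
    have hb : ((p : ℤ) - 1 - digit p m i n) * (p : ℤ) ^ n ≤ ((p : ℤ) - 1) * (p : ℤ) ^ n :=
      mul_le_mul_of_nonneg_right (by omega) hpn
    rw [hs, pow_succ]
    constructor
    · omega
    · nlinarith

theorem stepDelta_succ (hm : ¬ p ∣ m) (hi0 : 0 < i) (hi : i < m) (n a j : ℕ) (ha : a < p ^ n) :
    stepDelta p m i (n + 1) (a + j * p ^ n) =
      if (p : ℤ) - 1 - digit p m i n < j then -1
      else if (p : ℤ) - 1 - digit p m i n = j then stepDelta p m i n a else 0 := by
  have hs : threshold p m i (n + 1)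
      = threshold p m i n + ((p : ℤ) - 1 - digit p m i n) * (p : ℤ) ^ n := by
    simp only [threshold, Finset.sum_range_succ]; ring
  obtain ⟨ht1, ht2⟩ := threshold_bounds hm hi0 hi n
  have ha' : (a : ℤ) < (p : ℤ) ^ n := by exact_mod_cast ha
  have hpn : (0 : ℤ) ≤ (p : ℤ) ^ n := by positivity
  generalize (p : ℤ) - 1 - digit p m i n = e at hs ⊢
  unfold stepDelta
  rw [hs]
  push_cast
  rcases lt_trichotomy e j with h | h | h
  · rw [if_pos h, if_pos]
    nlinarith
  · rw [if_neg (show ¬ e < (j : ℤ) by omega), if_pos h, h]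
    have : threshold p m i n + (j : ℤ) * (p : ℤ) ^ n ≤ a + (j : ℤ) * (p : ℤ) ^ n ↔
        threshold p m i n ≤ a := by constructor <;> intro h <;> linarith
    simp only [this]
  · rw [if_neg (show ¬ e < (j : ℤ) by omega), if_neg (show ¬ e = (j : ℤ) by omega), if_neg]
    nlinarith

theorem sum_stepDelta (hm : ¬ p ∣ m) (hi0 : 0 < i) (hi : i < m) (n a : ℕ) (ha : a < p ^ n) :
    ∑ j ∈ Finset.range p, stepDelta p m i (n + 1) (a + j * p ^ n)
      = stepDelta p m i n a - digit p m i n := by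
  have h0 := digit_nonneg hm hi0 hi n
  have h1 := digit_lt hm hi0 hi n
  obtain ⟨k, hk⟩ := Int.eq_ofNat_of_zero_le h0
  have hkp : k < p := by omega
  obtain ⟨e, he⟩ : ∃ e, p = e + 1 + k := ⟨p - 1 - k, by omega⟩
  have hee : (p : ℤ) - 1 - digit p m i n = e := by rw [hk]; omega
  simp_rw [stepDelta_succ hm hi0 hi n a _ ha, hee, hk]
  have : Finset.range p = Finset.range (e + 1 + k) := by rw [he]
  rw [this, Finset.sum_range_add, Finset.sum_range_succ, Finset.sum_eq_zero]
  · rw [Finset.sum_congr rfl (g := fun _ => (-1 : ℤ))]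
    · simp [sub_eq_add_neg]
    · intro x _
      rw [if_pos (by push_cast; omega)]
  · intro x hx
    have := Finset.mem_range.1 hx
    rw [if_neg (by omega), if_neg (by omega)]

theorem sum_fiber {M : Type*} [AddCommMonoid M] (n : ℕ) (a : ZMod (p ^ n)) (f : ℕ → M) :
    ∑ b : ZMod (p ^ (n + 1)) with
      ZMod.castHom (pow_dvd_pow p n.le_succ) (ZMod (p ^ n)) b = a, f b.val
      = ∑ j ∈ Finset.range p, f (a.val + j * p ^ n) := by
  have hp : 0 < p := (Fact.out : p.Prime).pos
  have hpn : 0 < p ^ n := pow_pos hp n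
  have hav : a.val < p ^ n := ZMod.val_lt a
  have hbound : ∀ j, j < p → a.val + j * p ^ n < p ^ (n + 1) := fun j hj => by
    have : (j + 1) * p ^ n ≤ p * p ^ n := Nat.mul_le_mul_right _ hj
    rw [pow_succ, mul_comm (p ^ n) p]
    linarith
  have hval : ∀ b : ZMod (p ^ (n + 1)),
      ZMod.castHom (pow_dvd_pow p n.le_succ) (ZMod (p ^ n)) b = a ↔ b.val % p ^ n = a.val := by
    intro b
    rw [← (ZMod.val_injective (p ^ n)).eq_iff, ← ZMod.val_natCast]
    rw [ZMod.castHom_apply, ZMod.cast_eq_val]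
  symm
  refine Finset.sum_bij' (fun j _ => ((a.val + j * p ^ n : ℕ) : ZMod (p ^ (n + 1))))
    (fun b _ => b.val / p ^ n) ?_ ?_ ?_ ?_ ?_
  · intro j hj
    rw [Finset.mem_filter, hval, ZMod.val_natCast, Nat.mod_eq_of_lt (hbound j (Finset.mem_range.1 hj))]
    exact ⟨Finset.mem_univ _, by rw [Nat.add_mul_mod_self_right, Nat.mod_eq_of_lt hav]⟩
  · intro b _
    rw [Finset.mem_range, Nat.div_lt_iff_lt_mul hpn]
    exact (ZMod.val_lt b).trans_eq (by rw [Nat.succ_eq_add_one, pow_succ, mul_comm])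
  · intro j hj
    rw [ZMod.val_natCast, Nat.mod_eq_of_lt (hbound j (Finset.mem_range.1 hj)),
      Nat.add_mul_div_right _ _ hpn, Nat.div_eq_of_lt hav, zero_add]
  · intro b hb
    rw [Finset.mem_filter, hval] at hb
    rw [← hb.2, mul_comm, Nat.mod_add_div, ZMod.natCast_zmod_val]
  · intro j hj
    rw [ZMod.val_natCast, Nat.mod_eq_of_lt (hbound j (Finset.mem_range.1 hj))]

end Facts

/-- The measure `μ(i/m)`: for `0 ≤ a < p^n`, its value on `a + p^n ℤ_p` is
`[i p^(-n)]_m / m + δ_n(a)`. -/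
def hurwitzMeasure (p : ℕ) [Fact p.Prime] (m : ℕ) (hm : ¬ p ∣ m) (i : ℕ) (hi0 : 0 < i)
    (hi : i < m) : IwasawaAlgebra p :=
  IwasawaAlgebra.ofValues
    (fun n a => padicFrac p m hm (residueSeq p m i n) + (stepDelta p m i n a.val : ℤ_[p]))
    fun n a => by
      rw [sum_fiber n a fun x =>
        padicFrac p m hm (residueSeq p m i (n + 1)) + (stepDelta p m i (n + 1) x : ℤ_[p]),
        Finset.sum_add_distrib, ← Int.cast_sum,
        sum_stepDelta hm hi0 hi n a.val (ZMod.val_lt a)]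
      have hs := digit_spec (i := i) hm (by omega) n
      have hm0 : (m : ℚ_[p]) ≠ 0 := by
        have : m ≠ 0 := by omega
        exact_mod_cast this
      have hs' : (p : ℚ_[p]) * residueSeq p m i (n + 1)
          = residueSeq p m i n + digit p m i n * m := by
        exact_mod_cast congrArg (Int.cast : ℤ → ℚ_[p]) hs
      apply Subtype.ext
      simp only [Finset.sum_const, Finset.card_range, nsmul_eq_mul]
      push_cast
      simp only [padicFrac]
      field_simp
      rw [hs']
      ring

/-- The measure `μ_c(i/m) = μ(i/m) - c · (μ(i/m) ∘ c⁻¹)`. -/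
def hurwitzMeasureTwist (p : ℕ) [Fact p.Prime] (m : ℕ) (hm : ¬ p ∣ m) (i : ℕ) (hi0 : 0 < i)
    (hi : i < m) (c : ℤ_[p]ˣ) : IwasawaAlgebra p :=
  hurwitzMeasure p m hm i hi0 hi
    - (c : ℤ_[p]) • IwasawaAlgebra.compInv c (hurwitzMeasure p m hm i hi0 hi)

/-- The power series `(1 + T)^x = ∑ (x choose n) T^n` for `x ∈ ℤ_p`. -/
def onePlusT (p : ℕ) [Fact p.Prime] (x : ℤ_[p]) : PowerSeries ℤ_[p] :=
  PowerSeries.binomialSeries ℤ_[p] x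

/-- The embedding of `ℤ_p[[T]]` into its field of fractions. -/
abbrev toFractions (p : ℕ) [Fact p.Prime] :
    PowerSeries ℤ_[p] →+* FractionRing (PowerSeries ℤ_[p]) :=
  algebraMap (PowerSeries ℤ_[p]) (FractionRing (PowerSeries ℤ_[p]))

end

noncomputable section

open Polynomial PowerSeries Filter Topology

/-! The formula is a difference equation. Multiplying a measure by `(1) - 1` turns its values into
`μ(a - 1) - μ(a)`. For `μ(i/m)` the term `[i p^(-n)]_m / m` does not depend on `a` and cancels. What
remains is the cyclic difference of the step function `δ_n`: `+1` at the threshold and `-1` at `0`.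
The threshold is congruent to `i/m` mod `p^n`, so `((1) - 1) μ(i/m) = (i/m) - 1`. Dilating by `c`
gives `((c) - 1) (μ(i/m) ∘ c⁻¹) = (ci/m) - 1`. Applying `P`, with `P((x)) = (1+T)^x`, and dividing
yields both formulas.

The isomorphism is built from its inverse `T ↦ (1) - 1`. At level `n`, Weierstrass division
identifies `ℤ_p[[T]] / ((1+T)^(p^n) - 1)` with the polynomial quotient, which is the group ring of
`ℤ/p^n`. In the limit, injectivity holds because `(1+T)^(p^n) - 1` tends to `0`, and surjectivity
because `ℤ_p[[T]]` is compact in the product topology. Uniqueness holds because an algebra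
endomorphism of `ℤ_p[[T]]` fixing `T` is the identity. -/

/-- The polynomial `(1 + X)^(p^n) - 1`, whose quotient ring is the group ring of `ℤ/p^n`. -/
def cyclicPoly (p n : ℕ) [Fact p.Prime] : ℤ_[p][X] := (1 + Polynomial.X) ^ p ^ n - 1

/-! ### Finite level: power series modulo `(1+T)^(p^n) - 1` and the group ring of `ℤ/p^n`. -/

section Cyclic

variable (p : ℕ) [Fact p.Prime]

theorem monic_and_natDegree_cyclicPoly (n : ℕ) :
    (cyclicPoly p n).Monic ∧ (cyclicPoly p n).natDegree = p ^ n := by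
  have hN : p ^ n ≠ 0 := (pow_pos (Fact.out : p.Prime).pos n).ne'
  have hX : (1 + Polynomial.X : ℤ_[p][X]) = Polynomial.X + Polynomial.C 1 := by simp [add_comm]
  have hm : ((1 + Polynomial.X : ℤ_[p][X]) ^ p ^ n).Monic := by
    rw [hX]; exact (Polynomial.monic_X_add_C 1).pow _
  have hd : ((1 + Polynomial.X : ℤ_[p][X]) ^ p ^ n).natDegree = p ^ n := by
    rw [hX, (Polynomial.monic_X_add_C 1).natDegree_pow, Polynomial.natDegree_X_add_C, mul_one]
  have hlt : (1 : ℤ_[p][X]).degree < ((1 + Polynomial.X : ℤ_[p][X]) ^ p ^ n).degree := by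
    rw [Polynomial.degree_eq_natDegree hm.ne_zero, hd, Polynomial.degree_one]
    exact_mod_cast Nat.pos_of_ne_zero hN
  refine ⟨hm.sub_of_left hlt, ?_⟩
  rw [cyclicPoly, Polynomial.natDegree_sub_eq_left_of_natDegree_lt, hd]
  rw [hd, Polynomial.natDegree_one]
  exact Nat.pos_of_ne_zero hN

/-- `p` divides `(p^n choose k)` for `0 < k < p^n`. This is what makes Weierstrass division by the
polynomial available. -/
theorem isDistinguishedAt_cyclicPoly (n : ℕ) :
    (cyclicPoly p n).IsDistinguishedAt (IsLocalRing.maximalIdeal ℤ_[p]) where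
  monic := (monic_and_natDegree_cyclicPoly p n).1
  mem {k} hk := by
    rw [(monic_and_natDegree_cyclicPoly p n).2] at hk
    rw [cyclicPoly, Polynomial.coeff_sub, Polynomial.coeff_one_add_X_pow, Polynomial.coeff_one,
      PadicInt.maximalIdeal_eq_span_p, Ideal.mem_span_singleton]
    split_ifs with h
    · simp [h]
    · rw [sub_zero]
      exact_mod_cast Nat.cast_dvd_cast ((Fact.out : p.Prime).dvd_choose_pow h hk.ne)

theorem coe_cyclicPoly (n : ℕ) :
    (cyclicPoly p n : PowerSeries ℤ_[p]) = (1 + PowerSeries.X) ^ p ^ n - 1 := by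
  simp [cyclicPoly]

theorem cyclicPoly_dvd_succ (n : ℕ) :
    (cyclicPoly p n : PowerSeries ℤ_[p]) ∣ cyclicPoly p (n + 1) := by
  rw [coe_cyclicPoly, coe_cyclicPoly, pow_succ, pow_mul]
  simpa using sub_dvd_pow_sub_pow ((1 + PowerSeries.X : PowerSeries ℤ_[p]) ^ p ^ n) 1 p

theorem groupRing_single_eq_pow (n : ℕ) (a : ZMod (p ^ n)) :
    (AddMonoidAlgebra.single a 1 : AddMonoidAlgebra ℤ_[p] (ZMod (p ^ n))) =
      AddMonoidAlgebra.single 1 1 ^ a.val := by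
  rw [AddMonoidAlgebra.single_pow, one_pow]
  simp

theorem groupRing_single_one_pow (n : ℕ) :
    (AddMonoidAlgebra.single 1 1 : AddMonoidAlgebra ℤ_[p] (ZMod (p ^ n))) ^ p ^ n = 1 := by
  rw [AddMonoidAlgebra.single_pow, one_pow, AddMonoidAlgebra.one_def, nsmul_one]
  simp

/-- `X ↦ (1) - 1` induces `ℤ_p[X] / ((1 + X)^(p^n) - 1) → ℤ_p[ℤ/p^n]`. -/
def quotientToGroupRing (n : ℕ) :
    (ℤ_[p][X] ⧸ Ideal.span {cyclicPoly p n}) →ₐ[ℤ_[p]] AddMonoidAlgebra ℤ_[p] (ZMod (p ^ n)) :=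
  Ideal.Quotient.liftₐ _ (Polynomial.aeval (AddMonoidAlgebra.single 1 1 - 1)) fun a ha => by
    obtain ⟨b, rfl⟩ := Ideal.mem_span_singleton'.1 ha
    rw [map_mul, cyclicPoly, map_sub, map_pow, map_add, map_one, Polynomial.aeval_X,
      add_sub_cancel, groupRing_single_one_pow, sub_self, mul_zero]

theorem quotientToGroupRing_mk (n : ℕ) (f : ℤ_[p][X]) :
    quotientToGroupRing p n (Ideal.Quotient.mk _ f)
      = Polynomial.aeval (AddMonoidAlgebra.single 1 1 - 1) f :=
  rfl

theorem mk_one_add_X_pow (n : ℕ) :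
    Ideal.Quotient.mk (Ideal.span {cyclicPoly p n}) (1 + Polynomial.X) ^ p ^ n = 1 := by
  rw [← map_pow, ← sub_eq_zero, ← map_one (Ideal.Quotient.mk _), ← map_sub,
    Ideal.Quotient.eq_zero_iff_mem]
  exact Ideal.mem_span_singleton_self _

/-- `(a) ↦ (1 + X)^a` induces `ℤ_p[ℤ/p^n] → ℤ_p[X] / ((1 + X)^(p^n) - 1)`. -/
def groupRingToQuotient (n : ℕ) :
    AddMonoidAlgebra ℤ_[p] (ZMod (p ^ n)) →ₐ[ℤ_[p]] (ℤ_[p][X] ⧸ Ideal.span {cyclicPoly p n}) :=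
  AddMonoidAlgebra.lift _ _ _
    { toFun := fun a => Ideal.Quotient.mk _ (1 + Polynomial.X) ^ (Multiplicative.toAdd a).val
      map_one' := by simp
      map_mul' := fun a b => by
        rw [← pow_add, toAdd_mul, ZMod.val_add]
        exact (pow_eq_pow_mod _ (mk_one_add_X_pow p n)).symm }

theorem quotientToGroupRing_mk_X (n : ℕ) :
    quotientToGroupRing p n (Ideal.Quotient.mk _ Polynomial.X) = AddMonoidAlgebra.single 1 1 - 1 := by
  rw [quotientToGroupRing_mk, Polynomial.aeval_X]

theorem groupRingToQuotient_single (n : ℕ) (a : ZMod (p ^ n)) :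
    groupRingToQuotient p n (AddMonoidAlgebra.single a 1)
      = Ideal.Quotient.mk _ (1 + Polynomial.X) ^ a.val := by
  simp [groupRingToQuotient]

theorem groupRingToQuotient_single_one (n : ℕ) :
    groupRingToQuotient p n (AddMonoidAlgebra.single 1 1)
      = Ideal.Quotient.mk _ (1 + Polynomial.X) := by
  -- The representative of `1` is `1 % p^n`, which is `0` when `n = 0`; periodicity of the powers of
  -- `1 + X` covers that case too.
  rw [groupRingToQuotient_single, ZMod.val_one_eq_one_mod,
    ← pow_eq_pow_mod _ (mk_one_add_X_pow p n), pow_one]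

/-- The isomorphism `ℤ_p[X] / ((1 + X)^(p^n) - 1) ≃ ℤ_p[ℤ/p^n]`. -/
def quotientEquivGroupRing (n : ℕ) :
    (ℤ_[p][X] ⧸ Ideal.span {cyclicPoly p n}) ≃ₐ[ℤ_[p]] AddMonoidAlgebra ℤ_[p] (ZMod (p ^ n)) :=
  AlgEquiv.ofAlgHom (quotientToGroupRing p n) (groupRingToQuotient p n)
    (by
      refine AddMonoidAlgebra.algHom_ext (fun a => ?_) (Subsingleton.elim _ _)
      rw [AlgHom.comp_apply, groupRingToQuotient_single, map_pow, map_add, map_one, map_add,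
        map_one, quotientToGroupRing_mk_X, add_sub_cancel, AlgHom.id_apply,
        ← groupRing_single_eq_pow])
    (by
      refine Ideal.Quotient.algHom_ext _ (Polynomial.algHom_ext ?_)
      simp only [AlgHom.comp_apply, Ideal.Quotient.mkₐ_eq_mk, AlgHom.id_apply]
      rw [quotientToGroupRing_mk_X, map_sub, map_one, groupRingToQuotient_single_one, map_add,
        map_one, add_sub_cancel_left])

/-- The surjection `ℤ_p[[T]] → ℤ_p[ℤ/p^n]` with `T ↦ (1) - 1`. -/
def toGroupRing (n : ℕ) : PowerSeries ℤ_[p] →ₐ[ℤ_[p]] AddMonoidAlgebra ℤ_[p] (ZMod (p ^ n)) :=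
  ((isDistinguishedAt_cyclicPoly p n).algEquivQuotient.symm.trans
    (quotientEquivGroupRing p n)).toAlgHom.comp (Ideal.Quotient.mkₐ ℤ_[p] _)

theorem toGroupRing_apply (n : ℕ) (f : PowerSeries ℤ_[p]) :
    toGroupRing p n f = quotientEquivGroupRing p n
      ((isDistinguishedAt_cyclicPoly p n).algEquivQuotient.symm (Ideal.Quotient.mk _ f)) :=
  rfl

theorem toGroupRing_surjective (n : ℕ) : Function.Surjective (toGroupRing p n) :=
  ((isDistinguishedAt_cyclicPoly p n).algEquivQuotient.symm.trans
    (quotientEquivGroupRing p n)).surjective.comp Ideal.Quotient.mk_surjective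

theorem toGroupRing_eq_zero_iff (n : ℕ) (f : PowerSeries ℤ_[p]) :
    toGroupRing p n f = 0 ↔ (cyclicPoly p n : PowerSeries ℤ_[p]) ∣ f := by
  rw [toGroupRing_apply, map_eq_zero_iff _ (AlgEquiv.injective _),
    map_eq_zero_iff _ (AlgEquiv.injective _), Ideal.Quotient.eq_zero_iff_mem,
    Ideal.mem_span_singleton]

theorem toGroupRing_coe (n : ℕ) (f : ℤ_[p][X]) :
    toGroupRing p n f = Polynomial.aeval (AddMonoidAlgebra.single 1 1 - 1) f := by
  have : (isDistinguishedAt_cyclicPoly p n).algEquivQuotient.symm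
      (Ideal.Quotient.mk _ (f : PowerSeries ℤ_[p])) = Ideal.Quotient.mk _ f := by
    rw [AlgEquiv.symm_apply_eq]
    rfl
  rw [toGroupRing_apply, this]
  rfl

theorem toGroupRing_X (n : ℕ) :
    toGroupRing p n PowerSeries.X = AddMonoidAlgebra.single 1 1 - 1 := by
  rw [← Polynomial.coe_X, toGroupRing_coe, Polynomial.aeval_X]

/-- Reduces identities about `toGroupRing` to polynomials, on which it is plain evaluation. -/
theorem exists_polynomial_toGroupRing_eq (n : ℕ) (f : PowerSeries ℤ_[p]) :
    ∃ r : ℤ_[p][X], toGroupRing p n r = toGroupRing p n f := by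
  obtain ⟨q, hq⟩ := (quotientEquivGroupRing p n).surjective (toGroupRing p n f)
  obtain ⟨r, rfl⟩ := Ideal.Quotient.mk_surjective q
  refine ⟨r, ?_⟩
  rw [← hq, toGroupRing_coe]
  rfl

theorem groupRingReduction_toGroupRing (n : ℕ) (f : PowerSeries ℤ_[p]) :
    groupRingReduction p n (toGroupRing p (n + 1) f) = toGroupRing p n f := by
  obtain ⟨r, hr⟩ := exists_polynomial_toGroupRing_eq p (n + 1) f
  have hn : toGroupRing p n r = toGroupRing p n f := by
    rw [← sub_eq_zero, ← map_sub, toGroupRing_eq_zero_iff] at hr ⊢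
    exact (cyclicPoly_dvd_succ p n).trans hr
  rw [← hr, ← hn, toGroupRing_coe, toGroupRing_coe, ← Polynomial.aeval_algHom_apply]
  congr 2
  rw [map_sub, map_one]
  simp [groupRingReduction, ZMod.cast_one (pow_dvd_pow p n.le_succ)]

/-- The algebra map `ℤ_p[[T]] → ℤ_p[[ℤ_p]]` with `T ↦ (1) - 1`. -/
def toIwasawaAlgebra : PowerSeries ℤ_[p] →ₐ[ℤ_[p]] IwasawaAlgebra p :=
  (AlgHom.pi (toGroupRing p)).codRestrict _ fun f n => groupRingReduction_toGroupRing p n f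

theorem toIwasawaAlgebra_apply (f : PowerSeries ℤ_[p]) (n : ℕ) :
    (toIwasawaAlgebra p f : ∀ n : ℕ, AddMonoidAlgebra ℤ_[p] (ZMod (p ^ n))) n
      = toGroupRing p n f := rfl

/-! ### Passage to the limit: compactness and continuity in the product topology. -/

section Topology

open scoped PowerSeries.WithPiTopology

theorem continuous_onePlusT : Continuous (onePlusT p) := by
  refine continuous_pi fun d => ?_
  have : (fun x : ℤ_[p] => onePlusT p x d) = fun x => Ring.choose x (d ()) := by
    funext x
    have h := PowerSeries.binomialSeries_coeff (A := ℤ_[p]) x (d ())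
    rw [smul_eq_mul, mul_one] at h
    rw [← h, PowerSeries.coeff, ← Finsupp.unique_single d]
    rfl
  rw [this]
  exact PadicInt.continuous_choose _

theorem compactSpace_powerSeries : CompactSpace (PowerSeries ℤ_[p]) :=
  inferInstanceAs (CompactSpace ((Unit →₀ ℕ) → ℤ_[p]))

/-- A principal ideal is the image of a compact space under multiplication by its generator. -/
theorem isClosed_setOf_dvd (g : PowerSeries ℤ_[p]) : IsClosed {f | g ∣ f} := by
  have := compactSpace_powerSeries p
  have h : {f | g ∣ f} = Set.range (g * ·) := by
    ext f
    simp [Dvd.dvd, eq_comm]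
  rw [h]
  exact (isCompact_range (continuous_const_mul g)).isClosed

theorem onePlusT_natCast (k : ℕ) : onePlusT p k = (1 + PowerSeries.X) ^ k :=
  PowerSeries.binomialSeries_nat k

theorem onePlusT_add (x y : ℤ_[p]) : onePlusT p (x + y) = onePlusT p x * onePlusT p y :=
  PowerSeries.binomialSeries_add x y

/-- The polynomial equals `(1+T)^x - 1` at `x = p^n`, and `p^n → 0` in `ℤ_p`; continuity in `x` does
the rest. -/
theorem tendsto_cyclicPoly :
    Tendsto (fun n => (cyclicPoly p n : PowerSeries ℤ_[p])) atTop (𝓝 0) := by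
  have h1 : Tendsto (fun n : ℕ => (p : ℤ_[p]) ^ n) atTop (𝓝 0) := by
    refine tendsto_pow_atTop_nhds_zero_of_norm_lt_one ?_
    exact PadicInt.norm_natCast_lt_one_iff.2 dvd_rfl
  have h2 := (((continuous_onePlusT p).tendsto 0).comp h1).sub_const 1
  have h0 : onePlusT p 0 = 1 := PowerSeries.binomialSeries_zero
  rw [h0, sub_self] at h2
  refine h2.congr fun n => ?_
  rw [coe_cyclicPoly, ← onePlusT_natCast]
  simp

theorem toIwasawaAlgebra_injective : Function.Injective (toIwasawaAlgebra p) := by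
  rw [injective_iff_map_eq_zero]
  intro f hf
  have hdvd : ∀ n, (cyclicPoly p n : PowerSeries ℤ_[p]) ∣ f := fun n => by
    rw [← toGroupRing_eq_zero_iff, ← toIwasawaAlgebra_apply, hf]
    rfl
  choose h hh using hdvd
  ext k
  have ht := (PowerSeries.WithPiTopology.tendsto_iff_coeff_tendsto _ _ _ _).1 (tendsto_cyclicPoly p)
  have hz : Tendsto (fun n => PowerSeries.coeff k ((cyclicPoly p n : PowerSeries ℤ_[p]) * h n))
      atTop (𝓝 0) := by
    -- The cofactors `h n` need not converge, but their coefficients have norm at most `1`, so each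
    -- of the finitely many products tends to `0`.
    simp_rw [PowerSeries.coeff_mul]
    rw [← Finset.sum_const_zero (s := Finset.HasAntidiagonal.antidiagonal k)]
    refine tendsto_finsetSum _ fun ij _ => ?_
    refine squeeze_zero_norm (fun n => ?_) ((ht ij.1).norm.trans (by simp))
    rw [norm_mul]
    exact mul_le_of_le_one_right (norm_nonneg _) (PadicInt.norm_le_one _)
  simp_rw [← hh] at hz
  simpa using tendsto_nhds_unique tendsto_const_nhds hz

theorem toIwasawaAlgebra_surjective : Function.Surjective (toIwasawaAlgebra p) := by
  intro μ
  have := compactSpace_powerSeries p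
  choose F hF using fun n => toGroupRing_surjective p n
    ((μ : ∀ n : ℕ, AddMonoidAlgebra ℤ_[p] (ZMod (p ^ n))) n)
  have hiff : ∀ n f, f ∈ (fun f => f - F n) ⁻¹' {f | (cyclicPoly p n : PowerSeries ℤ_[p]) ∣ f} ↔
      toGroupRing p n f = (μ : ∀ n : ℕ, AddMonoidAlgebra ℤ_[p] (ZMod (p ^ n))) n := fun n f => by
    rw [Set.mem_preimage, Set.mem_ofPred_eq, ← toGroupRing_eq_zero_iff, map_sub, sub_eq_zero, hF]
  have hclosed : ∀ n, IsClosed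
      ((fun f => f - F n) ⁻¹' {f | (cyclicPoly p n : PowerSeries ℤ_[p]) ∣ f}) := fun n =>
    (isClosed_setOf_dvd p _).preimage (continuous_id.sub continuous_const)
  -- The lifts of the `n`-th component of `μ` form a coset of a closed ideal. These cosets are
  -- nonempty, compact and nested, so they have a common point.
  obtain ⟨f, hf⟩ := IsCompact.nonempty_iInter_of_sequence_nonempty_isCompact_isClosed
    (fun n => (fun f => f - F n) ⁻¹' {f | (cyclicPoly p n : PowerSeries ℤ_[p]) ∣ f})
    (fun n f hf => by
      rw [hiff] at hf ⊢
      rw [← groupRingReduction_toGroupRing, hf]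
      exact μ.2 n)
    (fun n => ⟨F n, (hiff n _).2 (hF n)⟩) (hclosed 0).isCompact hclosed
  refine ⟨f, Subtype.ext (funext fun n => ?_)⟩
  exact (hiff n f).1 (Set.mem_iInter.1 hf n)

/-- For natural `y` this is `u - 1 ∣ u^y - 1` with `u = (1+T)^(p^n)`; the condition is closed in `y`
and the naturals are dense in `ℤ_p`. -/
theorem cyclicPoly_dvd_onePlusT_sub_one (n : ℕ) (y : ℤ_[p]) :
    (cyclicPoly p n : PowerSeries ℤ_[p]) ∣ onePlusT p ((p : ℤ_[p]) ^ n * y) - 1 := by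
  have hc : IsClosed {y : ℤ_[p] |
      (cyclicPoly p n : PowerSeries ℤ_[p]) ∣ onePlusT p ((p : ℤ_[p]) ^ n * y) - 1} :=
    (isClosed_setOf_dvd p _).preimage
      (((continuous_onePlusT p).comp (continuous_const_mul _)).sub continuous_const)
  refine PadicInt.denseRange_natCast.induction_on (p := fun y =>
    (cyclicPoly p n : PowerSeries ℤ_[p]) ∣ onePlusT p ((p : ℤ_[p]) ^ n * y) - 1) y hc fun k => ?_
  have : onePlusT p ((p : ℤ_[p]) ^ n * k) = ((1 + PowerSeries.X) ^ p ^ n) ^ k := by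
    rw [← pow_mul, ← onePlusT_natCast]
    simp
  rw [this, coe_cyclicPoly]
  simpa using sub_dvd_pow_sub_pow ((1 + PowerSeries.X : PowerSeries ℤ_[p]) ^ p ^ n) 1 k

end Topology

/-- At level `n`, split `x = p^n y + a` with `a` natural: the factor `(1+T)^(p^n y)` maps to `1`,
and `(1+T)^a` maps to a power of `(1)`. -/
theorem toIwasawaAlgebra_onePlusT (x : ℤ_[p]) :
    toIwasawaAlgebra p (onePlusT p x) = IwasawaAlgebra.single x := by
  refine Subtype.ext (funext fun n => ?_)
  rw [toIwasawaAlgebra_apply]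
  change _ = AddMonoidAlgebra.single (PadicInt.toZModPow n x) 1
  have hx : x - ((PadicInt.toZModPow n x).val : ℤ_[p]) ∈ Ideal.span {(p : ℤ_[p]) ^ n} := by
    rw [← PadicInt.ker_toZModPow, RingHom.mem_ker]
    simp
  obtain ⟨y, hy⟩ := Ideal.mem_span_singleton'.1 hx
  have hx' : x = (p : ℤ_[p]) ^ n * y + ((PadicInt.toZModPow n x).val : ℤ_[p]) := by
    rw [mul_comm, hy]; ring
  have h1 : toGroupRing p n (onePlusT p ((p : ℤ_[p]) ^ n * y)) = 1 := by
    rw [← sub_eq_zero, ← map_one (toGroupRing p n), ← map_sub, toGroupRing_eq_zero_iff]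
    exact cyclicPoly_dvd_onePlusT_sub_one p n y
  conv_lhs => rw [hx']
  rw [onePlusT_add, map_mul, h1, one_mul, onePlusT_natCast, map_pow, map_add, map_one,
    toGroupRing_X, add_sub_cancel, ← groupRing_single_eq_pow]

/-- The Iwasawa isomorphism `ℤ_p[[ℤ_p]] ≃ ℤ_p[[T]]`. -/
def iwasawaEquiv : IwasawaAlgebra p ≃ₐ[ℤ_[p]] PowerSeries ℤ_[p] :=
  (AlgEquiv.ofBijective (toIwasawaAlgebra p)
    ⟨toIwasawaAlgebra_injective p, toIwasawaAlgebra_surjective p⟩).symm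

theorem iwasawaEquiv_single (x : ℤ_[p]) :
    iwasawaEquiv p (IwasawaAlgebra.single x) = onePlusT p x := by
  rw [iwasawaEquiv, AlgEquiv.symm_apply_eq]
  exact (toIwasawaAlgebra_onePlusT p x).symm

theorem onePlusT_one : onePlusT p 1 = 1 + PowerSeries.X := by
  simpa using onePlusT_natCast p 1

end Cyclic

/-! ### Uniqueness of the Iwasawa isomorphism. -/

theorem PowerSeries.algHom_apply_eq_self {R : Type*} [CommRing R]
    (φ : PowerSeries R →ₐ[R] PowerSeries R) (hφ : φ PowerSeries.X = PowerSeries.X)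
    (f : PowerSeries R) : φ f = f := by
  have hpoly : ∀ q : R[X], φ q = q := fun q => by
    have : (φ.comp (Polynomial.coeToPowerSeries.algHom R)) = Polynomial.coeToPowerSeries.algHom R :=
      Polynomial.algHom_ext (by simp [hφ])
    simpa using DFunLike.congr_fun this q
  ext n
  -- Continuity of `φ` is not assumed. It is replaced by the fact that `φ` preserves divisibility by
  -- powers of `X`, while it fixes the truncation of `f`.
  have hdvd : (PowerSeries.X : PowerSeries R) ^ (n + 1) ∣ f - (PowerSeries.trunc (n + 1) f : R[X]) := by
    rw [PowerSeries.X_pow_dvd_iff]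
    intro k hk
    rw [map_sub, Polynomial.coeff_coe, PowerSeries.coeff_trunc, if_pos hk, sub_self]
  obtain ⟨g, hg⟩ := hdvd
  have h1 : φ f - f = PowerSeries.X ^ (n + 1) * (φ g - g) := by
    have h2 := congrArg φ hg
    rw [map_sub, hpoly, map_mul, map_pow, hφ] at h2
    linear_combination h2 - hg
  have h3 := PowerSeries.X_pow_dvd_iff.1 ⟨_, h1⟩ n n.lt_succ_self
  rwa [map_sub, sub_eq_zero] at h3

theorem eq_iwasawaEquiv {p : ℕ} [Fact p.Prime] (P : IwasawaAlgebra p ≃ₐ[ℤ_[p]] PowerSeries ℤ_[p])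
    (hP : P (IwasawaAlgebra.single 1) = 1 + PowerSeries.X) : P = iwasawaEquiv p := by
  ext1 μ
  have h1 : (iwasawaEquiv p).symm (1 + PowerSeries.X) = IwasawaAlgebra.single 1 := by
    rw [AlgEquiv.symm_apply_eq, iwasawaEquiv_single, onePlusT_one]
  have h := PowerSeries.algHom_apply_eq_self
    ((iwasawaEquiv p).symm.trans P).toAlgHom (by
      have h2 : P ((iwasawaEquiv p).symm (1 + PowerSeries.X)) = 1 + PowerSeries.X := by rw [h1, hP]
      rw [map_add, map_one, map_add, map_one] at h2
      exact add_left_cancel h2) (iwasawaEquiv p μ)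
  simpa using h

end

noncomputable section

/-! ### Values of products with group elements, and dilation by a unit. -/

namespace IwasawaAlgebra

variable {p : ℕ} [Fact p.Prime]

theorem ext_value {μ ν : IwasawaAlgebra p} (h : ∀ n a, μ.value n a = ν.value n a) : μ = ν :=
  Subtype.ext (funext fun n => AddMonoidAlgebra.ext (Finsupp.ext (h n)))

theorem value_sub (μ ν : IwasawaAlgebra p) (n : ℕ) (a : ZMod (p ^ n)) :
    (μ - ν).value n a = μ.value n a - ν.value n a := rfl

theorem value_single (x : ℤ_[p]) (n : ℕ) (a : ZMod (p ^ n)) :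
    (single x).value n a = if PadicInt.toZModPow n x = a then 1 else 0 := by
  classical
  rw [value, single, AddMonoidAlgebra.coeff_single, Finsupp.single_apply]

theorem value_single_mul (x : ℤ_[p]) (μ : IwasawaAlgebra p) (n : ℕ) (a : ZMod (p ^ n)) :
    (single x * μ).value n a = μ.value n (a - PadicInt.toZModPow n x) := by
  have h := AddMonoidAlgebra.coeff_single_mul_apply
    ((μ : ∀ n : ℕ, AddMonoidAlgebra ℤ_[p] (ZMod (p ^ n))) n) 1 (PadicInt.toZModPow n x) a
  rw [one_mul, neg_add_eq_sub] at h
  exact h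

theorem single_zero : single (0 : ℤ_[p]) = 1 :=
  Subtype.ext (funext fun n => by simp [single, AddMonoidAlgebra.one_def])

theorem value_one (n : ℕ) (a : ZMod (p ^ n)) :
    (1 : IwasawaAlgebra p).value n a = if 0 = a then 1 else 0 := by
  rw [← single_zero, value_single, map_zero]

theorem value_compInv (c : ℤ_[p]ˣ) (μ : IwasawaAlgebra p) (n : ℕ) (a : ZMod (p ^ n)) :
    (compInv c μ).value n a = μ.value n (PadicInt.toZModPow n (↑c⁻¹ : ℤ_[p]) * a) :=
  value_ofValues _ _ _ _

theorem single_sub_one_mul_compInv (c : ℤ_[p]ˣ) {x : ℤ_[p]} {μ : IwasawaAlgebra p}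
    (h : (single 1 - 1) * μ = single x - 1) :
    (single (c : ℤ_[p]) - 1) * compInv c μ = single ((c : ℤ_[p]) * x) - 1 := by
  refine ext_value fun n a => ?_
  have hc : PadicInt.toZModPow n (↑c⁻¹ : ℤ_[p]) * PadicInt.toZModPow n (c : ℤ_[p]) = 1 := by
    rw [← map_mul]; simp
  have hiff : ∀ y, PadicInt.toZModPow n (c : ℤ_[p]) * y = a ↔
      y = PadicInt.toZModPow n (↑c⁻¹ : ℤ_[p]) * a := fun y => by
    constructor
    · rintro rfl
      rw [← mul_assoc, hc, one_mul]
    · rintro rfl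
      rw [← mul_assoc, mul_comm (PadicInt.toZModPow n (c : ℤ_[p])), hc, one_mul]
  -- The hypothesis read at `c⁻¹ a` is the claim at `a`, since a shift by `c` before dilation is a
  -- shift by `1` after it: `c⁻¹ (a - c) = c⁻¹ a - 1`.
  have h' := congrArg (fun ν => value ν n (PadicInt.toZModPow n (↑c⁻¹ : ℤ_[p]) * a)) h
  simp only [sub_mul, one_mul, value_sub, value_single_mul, value_single, value_one,
    map_one] at h'
  have h0 := hiff 0
  rw [mul_zero] at h0
  simp only [sub_mul, one_mul, value_sub, value_single_mul, value_single, value_one,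
    value_compInv, mul_sub, hc, h', map_mul, hiff, h0]

end IwasawaAlgebra

/-! ### The difference equation for `μ(i/m)`. -/

section Hurwitz

variable {p m i : ℕ} [Fact p.Prime]

/-- The digit recursion telescopes. Modulo `p^n` the result says that the threshold represents
`i/m`. -/
theorem mul_threshold (hm : ¬ p ∣ m) (hi : i < m) (n : ℕ) :
    (m : ℤ) * threshold p m i n = (p : ℤ) ^ n * (m - residueSeq p m i n) + i := by
  induction n with
  | zero => simp [threshold, residueSeq_zero hi]
  | succ n ih =>
    have hs : threshold p m i (n + 1)
        = threshold p m i n + ((p : ℤ) - 1 - digit p m i n) * (p : ℤ) ^ n := by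
      simp only [threshold, Finset.sum_range_succ]; ring
    have hd := digit_spec (i := i) hm (by omega) n
    rw [hs]
    linear_combination ih + (p : ℤ) ^ n * hd

theorem natCast_mul_padicFrac (hm : ¬ p ∣ m) (hm0 : m ≠ 0) (a : ℕ) :
    (m : ℤ_[p]) * padicFrac p m hm a = a := by
  apply Subtype.ext
  push_cast
  rw [padicFrac]
  exact mul_div_cancel₀ _ (by exact_mod_cast hm0)

theorem toZModPow_padicFrac (hm : ¬ p ∣ m) (hi : i < m) (n : ℕ) :
    PadicInt.toZModPow n (padicFrac p m hm i) = (threshold p m i n : ZMod (p ^ n)) := by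
  have hu : IsUnit (m : ZMod (p ^ n)) :=
    (ZMod.isUnit_iff_coprime _ _).2
      ((((Fact.out : p.Prime).coprime_iff_not_dvd).2 hm).pow_left n).symm
  apply hu.mul_left_cancel
  have h1 := congrArg (PadicInt.toZModPow n) (natCast_mul_padicFrac hm (by omega) i)
  have h2 := congrArg (Int.cast : ℤ → ZMod (p ^ n)) (mul_threshold hm hi n)
  have hp : (p : ZMod (p ^ n)) ^ n = 0 := by exact_mod_cast ZMod.natCast_self (p ^ n)
  push_cast at h2
  rw [map_mul, map_natCast, map_natCast] at h1
  rw [h1, h2, hp, zero_mul, zero_add]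

/-- Around the cycle `ℤ/p^n`, `δ_n` drops at the threshold and returns to `0` on wrapping from `p^n
- 1` to `0`. If the threshold is `p^n`, then `δ_n` vanishes and the two indicators on the right
cancel. -/
theorem stepDelta_sub_stepDelta (hm : ¬ p ∣ m) (hi0 : 0 < i) (hi : i < m) (n : ℕ)
    (a : ZMod (p ^ n)) :
    stepDelta p m i n (a - 1).val - stepDelta p m i n a.val =
      (if (threshold p m i n : ZMod (p ^ n)) = a then 1 else 0) - (if 0 = a then 1 else 0) := by
  obtain ⟨h1, h2⟩ := threshold_bounds hm hi0 hi n
  obtain ⟨t, ht⟩ := Int.eq_ofNat_of_zero_le (show 0 ≤ threshold p m i n by omega)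
  simp only [stepDelta, ht] at h1 h2 ⊢
  have hpn : 0 < p ^ n := pow_pos (Fact.out : p.Prime).pos n
  have htN : t ≤ p ^ n := by exact_mod_cast h2
  have ht1 : 1 ≤ t := by exact_mod_cast h1
  generalize p ^ n = N at *
  have : NeZero N := ⟨hpn.ne'⟩
  have hk : a.val < N := ZMod.val_lt a
  obtain ⟨k, hka⟩ : ∃ k, a.val = k := ⟨_, rfl⟩
  have ha : a = (k : ZMod N) := by rw [← hka, ZMod.natCast_zmod_val]
  rw [hka] at hk
  have hpred : (a - 1).val = if k = 0 then N - 1 else k - 1 := by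
    have hb : a - 1 = ((if k = 0 then N - 1 else k - 1 : ℕ) : ZMod N) := by
      split_ifs with h
      · rw [ha, h, Nat.cast_sub hpn]; simp
      · rw [ha, Nat.cast_sub (by omega)]; simp
    rw [hb, ZMod.val_natCast, Nat.mod_eq_of_lt]
    split_ifs <;> omega
  have hta : (((t : ℤ) : ZMod N) = a) ↔ t = k ∨ (t = N ∧ k = 0) := by
    rw [ha, Int.cast_natCast, ZMod.natCast_eq_natCast_iff', Nat.mod_eq_of_lt hk]
    rcases htN.lt_or_eq with h | rfl
    · rw [Nat.mod_eq_of_lt h]; omega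
    · rw [Nat.mod_self]; omega
  have h0a : (0 = a) ↔ k = 0 := by
    rw [eq_comm, ← ZMod.val_eq_zero, hka]
  simp only [hpred, hta, h0a, hka]
  split_ifs <;> omega

theorem single_sub_one_mul_hurwitzMeasure (hm : ¬ p ∣ m) (hi0 : 0 < i) (hi : i < m) :
    (IwasawaAlgebra.single 1 - 1) * hurwitzMeasure p m hm i hi0 hi
      = IwasawaAlgebra.single (padicFrac p m hm i) - 1 := by
  refine IwasawaAlgebra.ext_value fun n a => ?_
  rw [sub_mul, one_mul, IwasawaAlgebra.value_sub, IwasawaAlgebra.value_sub,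
    IwasawaAlgebra.value_single_mul, IwasawaAlgebra.value_single, IwasawaAlgebra.value_one, map_one,
    toZModPow_padicFrac hm hi, hurwitzMeasure, IwasawaAlgebra.value_ofValues,
    IwasawaAlgebra.value_ofValues, add_sub_add_left_eq_sub]
  exact_mod_cast congrArg (Int.cast : ℤ → ℤ_[p]) (stepDelta_sub_stepDelta hm hi0 hi n a)

end Hurwitz

/-- Its coefficient of `T` is `x`. This permits division by `(1+T)^c - 1`. -/
theorem onePlusT_sub_one_ne_zero {p : ℕ} [Fact p.Prime] {x : ℤ_[p]} (hx : x ≠ 0) :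
    onePlusT p x - 1 ≠ 0 := by
  intro h
  have h1 := congrArg (PowerSeries.coeff 1) h
  simp [onePlusT, PowerSeries.coeff_one] at h1
  exact hx h1

end

theorem corollary1p3 (p : ℕ) [Fact p.Prime] :
    (∃! P : IwasawaAlgebra p ≃ₐ[ℤ_[p]] PowerSeries ℤ_[p],
      P (IwasawaAlgebra.single 1) = 1 + PowerSeries.X) ∧
    ∀ P : IwasawaAlgebra p ≃ₐ[ℤ_[p]] PowerSeries ℤ_[p],
      P (IwasawaAlgebra.single 1) = 1 + PowerSeries.X →
      ∀ (m : ℕ) (hm : ¬ p ∣ m) (i : ℕ) (hi0 : 0 < i) (hi : i < m),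
        toFractions p (P (hurwitzMeasure p m hm i hi0 hi)) =
            toFractions p (onePlusT p (padicFrac p m hm i) - 1) /
              toFractions p PowerSeries.X ∧
        ∀ c : ℤ_[p]ˣ, c ^ (p - 1) ≠ 1 →
          toFractions p (P (hurwitzMeasureTwist p m hm i hi0 hi c)) =
            toFractions p (onePlusT p (padicFrac p m hm i) - 1) /
                toFractions p PowerSeries.X -
              toFractions p
                  (PowerSeries.C (c : ℤ_[p]) * (onePlusT p (c * padicFrac p m hm i) - 1)) /
                toFractions p (onePlusT p c - 1) := by
  refine ⟨⟨iwasawaEquiv p, ?_, fun P hP => eq_iwasawaEquiv P hP⟩, ?_⟩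
  · exact (iwasawaEquiv_single p 1).trans (onePlusT_one p)
  intro P hP m hm i hi0 hi
  obtain rfl := eq_iwasawaEquiv P hP
  have hne : ∀ f : PowerSeries ℤ_[p], f ≠ 0 → toFractions p f ≠ 0 := fun f hf =>
    (map_ne_zero_iff _ (IsFractionRing.injective _ _)).2 hf
  have hμ := single_sub_one_mul_hurwitzMeasure hm hi0 hi
  have h1 : toFractions p (iwasawaEquiv p (hurwitzMeasure p m hm i hi0 hi)) =
      toFractions p (onePlusT p (padicFrac p m hm i) - 1) / toFractions p PowerSeries.X := by
    have h := congrArg (iwasawaEquiv p) hμ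
    rw [map_mul, map_sub, map_sub, map_one, iwasawaEquiv_single, iwasawaEquiv_single,
      onePlusT_one, add_sub_cancel_left] at h
    rw [eq_div_iff (hne _ PowerSeries.X_ne_zero), ← map_mul, mul_comm, h]
  refine ⟨h1, fun c _ => ?_⟩
  have h := congrArg (iwasawaEquiv p) (IwasawaAlgebra.single_sub_one_mul_compInv c hμ)
  rw [map_mul, map_sub, map_sub, map_one, iwasawaEquiv_single, iwasawaEquiv_single] at h
  rw [hurwitzMeasureTwist, map_sub, map_smul, map_sub, h1, PowerSeries.smul_eq_C_mul, ← h]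
  congr 1
  rw [eq_div_iff (hne _ (onePlusT_sub_one_ne_zero c.ne_zero)), ← map_mul]
  congr 1
  ring
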